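/- \textbf{Setting.} A finite set $\mathcal N$ of users, a finite nonempty set $\mathcal T$ of time slots and a finite set $\mathcal L$ of constraints are given, with unit prices $p_t\in\mathbb R$, a peak price $p_0\ge 0$, coefficient vectors $\mathbf a^{i,l}=(a^{i,l}_t)_{t\in\mathcal T}\in\mathbb R^{\mathcal T}$, bounds $b^l\in\mathbb R$, and utility functions $v^i_t:\mathbb R\to\mathbb R$ that are twice differentiable and strictly concave. Put $v^i(\mathbf x^i)=\sum_t v^i_t(x^i_t)$. Assume that the feasible set $$\mathcal X=\Big\{\mathbf x=(\mathbf x^i)_{i\in\mathcal N}:\ \sum_{i}\mathbf a^{i,l}\cdot\mathbf x^i\le b^l\ \ \forall l\in\mathcal L\Big\}$$ is a nonempty polytope (in particular bounded). An \emph{optimal allocation} is a maximizer over $\mathbf x\in\mathcal X$ of $$\sum_i v^i(\mathbf x^i)-\sum_t p_t\sum_i x^i_t-p_0\max_t\sum_i x^i_t .$$ Let $\mathcal{GR}$ be a connected graph on $\mathcal N$ (the message-exchange network), let $G$ be any spanning tree of it, let $\mathcal N(i)$ be the set of neighbours of $i$ in $G$, and let $\phi:\mathcal N\to\mathcal N$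 be any map with $\phi(i)\in\mathcal N(i)$ for all $i$ (the helper of $i$; in particular there are at least two users). \textbf{Mechanism.} User $i$ chooses a message $$m^i=\big(y^i_t,\ q^{i,l},\ s^i_t,\ (\beta^{i,j}_t)_{j:\phi(j)=i},\ (n^{i,j,l})_{j\in\mathcal N(i)},\ (\nu^{i,j}_t)_{j\in\mathcal N(i)}\big)_{t\in\mathcal T,\,l\in\mathcal L}$$ with $q^{i,l},s^i_t\ge 0$ and all other components arbitrary reals. She receives the allocation $\hat x^i_t(m)=y^i_t$ and pays the tax $$\hat t^i(m)=\mathrm{cost}^i+\sum_l\big(\mathrm{pr}n^{i,l}+\mathrm{con}^{i,l}\big)+\sum_t\big(\mathrm{pr}\beta^i_t+\mathrm{pr}\nu^i_t+\mathrm{con}^i_t\big),$$ where \begin{align*} \mathrm{cost}^i&=\sum_t\big(p_t+\mathcal{RP}_t(\mathbf s^{-i},\boldsymbol\zeta^{-i})\big)y^i_t+\sum_{l\in\mathcal L_i}q^{-i,l}\,\mathbf a^{i,l}\cdot\mathbf y^i,\qquad \mathcal L_i=\{l:\mathbf a^{i,l}\ne\mathbf 0\},\\ \mathrm{con}^{i,l}&=(q^{i,l}-q^{-i,l})^2+q^{i,l}\Big(b^l-\sum_{j\in\mathcal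 N(i)}f^{i,j,l}-\mathbf a^{i,l}\cdot\boldsymbol\beta^{\phi(i),i}\Big),\\ \mathrm{con}^i_t&=(s^i_t-s^{-i}_t)^2+s^i_t(z^{-i}-\zeta^{-i}_t),\\ \mathrm{pr}n^{i,l}&=\sum_{j\in\mathcal N(i)}(n^{i,j,l}-f^{i,j,l})^2,\quad \mathrm{pr}\beta^i_t=\sum_{j:\phi(j)=i}(\beta^{i,j}_t-y^j_t)^2,\quad \mathrm{pr}\nu^i_t=\sum_{j\in\mathcal N(i)}(\nu^{i,j}_t-f^{i,j}_t)^2,\\ f^{i,j,l}&=\mathbf a^{j,l}\cdot\mathbf y^j+\sum_{h\in\mathcal N(j)\setminus\{i\}}n^{j,h,l},\qquad f^{i,j}_t=y^j_t+\sum_{h\in\mathcal N(j)\setminus\{i\}}\nu^{j,h}_t,\\ s^{-i}_t&=\frac1{|\mathcal N(i)|}\sum_{j\in\mathcal N(i)}s^j_t,\qquad q^{-i,l}=\frac1{|\mathcal N(i)|}\sum_{j\in\mathcal N(i)}q^{j,l},\\ \zeta^{-i}_t&=\sum_{j\in\mathcal N(i)}f^{i,j}_t+\beta^{\phi(i),i}_t,\qquad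 z^{-i}=\max_t\zeta^{-i}_t , \end{align*} and where $\mathcal{RP}_t(\mathbf s,\mathbf d)=p_0\,s_t/\sum_{t'}s_{t'}$ if $\mathbf s\ne\mathbf 0$, while $\mathcal{RP}_t(\mathbf 0,\mathbf d)$ equals $p_0/\#\arg\max_{t'}d_{t'}$ if $t\in\arg\max_{t'}d_{t'}$ and $0$ otherwise. The payoff of user $i$ in the induced game is $u^i(m)=v^i(\hat{\mathbf x}^i(m))-\hat t^i(m)$. \textbf{Theorem.} There is exactly one optimal allocation. The induced game has a (pure-strategy) Nash equilibrium, and for every Nash equilibrium $m$ the allocation $\hat{\mathbf x}(m)$ is the optimal allocation. -/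

import Mathlib

open scoped BigOperators NNReal

noncomputable section

/-- The data of an energy community: users `ι`, time slots `τ`, linear constraints `κ`.
`a i l t` is the coefficient of the demand of user `i` at time `t` in constraint `l`. -/
structure EnergyCommunity (ι τ κ : Type*) where
  /-- the utility of user `i` for her demand at time `t` -/
  v : ι → τ → ℝ → ℝ
  /-- the unit price at time `t` -/
  price : τ → ℝ
  /-- the unit price for the peak demand -/
  peakPrice : ℝ
  a : ι → κ → τ → ℝ
  b : κ → ℝ

namespace EnergyCommunity

variable {ι τ κ : Type*} [Fintype ι] [Fintype τ] [Nonempty τ] [Fintype κ]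

/-- The maximum of finitely many real numbers. -/
def peak (d : τ → ℝ) : ℝ := Finset.univ.sup' Finset.univ_nonempty d

/-- The utility of user `i` for a demand vector. -/
def utility (E : EnergyCommunity ι τ κ) (i : ι) (x : τ → ℝ) : ℝ := ∑ t, E.v i t (x t)

/-- The cost of energy to the community. -/
def energyCost (E : EnergyCommunity ι τ κ) (x : ι → τ → ℝ) : ℝ :=
  (∑ t, E.price t * ∑ i, x i t) + E.peakPrice * peak (fun t => ∑ i, x i t)

/-- The feasible set. -/
def feasible (E : EnergyCommunity ι τ κ) : Set (ι → τ → ℝ) :=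
  {x | ∀ l, ∑ i, ∑ t, E.a i l t * x i t ≤ E.b l}

/-- Total utility minus cost of energy. -/
def welfare (E : EnergyCommunity ι τ κ) (x : ι → τ → ℝ) : ℝ :=
  (∑ i, E.utility i (x i)) - E.energyCost x

/-- `x` solves the demand management problem. -/
def IsOptimalAllocation (E : EnergyCommunity ι τ κ) (x : ι → τ → ℝ) : Prop :=
  x ∈ E.feasible ∧ ∀ x' ∈ E.feasible, E.welfare x' ≤ E.welfare x

open Classical in
/-- The radial pricing operator. -/
def radialPrice (p₀ : ℝ) (s d : τ → ℝ) (t : τ) : ℝ :=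
  if s ≠ 0 then s t / (∑ t', s t') * p₀
  else if d t = peak d then p₀ / (Finset.univ.filter fun t' => d t' = peak d).card
  else 0

open Classical in
/-- The constraints in which the demand of user `i` occurs. -/
def constraintsOf (E : EnergyCommunity ι τ κ) (i : ι) : Finset κ :=
  Finset.univ.filter fun l => E.a i l ≠ 0

end EnergyCommunity

/-- The message space of user `i` when messages are exchanged along the graph `G` and `φ j` is
the helper of user `j`: demands `y`, nonnegative prices `q` and `s`, the proxies `β j` for the
demands of those `j` whose helper is `i`, and for every neighbour `j` the summaries `n j`, `ν j`
of the demands of the users connected to `i` via `j`. -/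
structure Message {ι : Type*} (G : SimpleGraph ι) (φ : ι → ι) (τ κ : Type*) (i : ι) where
  y : τ → ℝ
  q : κ → ℝ≥0
  s : τ → ℝ≥0
  β : {j : ι // φ j = i} → τ → ℝ
  n : G.neighborSet i → κ → ℝ
  ν : G.neighborSet i → τ → ℝ

/-- Message profiles. -/
abbrev Profile {ι : Type*} (G : SimpleGraph ι) (φ : ι → ι) (τ κ : Type*) : Type _ :=
  (i : ι) → Message G φ τ κ i

namespace Profile

variable {ι τ κ : Type*} [Fintype ι] [DecidableEq ι] [Fintype τ] [Nonempty τ] [Fintype κ]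
variable {G : SimpleGraph ι} [DecidableRel G.Adj] {φ : ι → ι}

/-- Every user is allocated what she demands. -/
def alloc (m : Profile G φ τ κ) (i : ι) (t : τ) : ℝ := (m i).y t

/-- The proxy that the helper of `i` quotes for the demand of `i`. -/
def helperProxy (m : Profile G φ τ κ) (i : ι) (t : τ) : ℝ := (m (φ i)).β ⟨i, rfl⟩ t

/-- `f^{i,j,l}`, for a neighbour `j` of `i`. -/
def fCon (E : EnergyCommunity ι τ κ) (m : Profile G φ τ κ) (i j : ι) (l : κ) : ℝ :=
  (∑ t, E.a j l t * (m j).y t) + ∑ h : G.neighborSet j with h.val ≠ i, (m j).n h l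

/-- `f^{i,j}_t`, for a neighbour `j` of `i`. -/
def fPeak (m : Profile G φ τ κ) (i j : ι) (t : τ) : ℝ :=
  (m j).y t + ∑ h : G.neighborSet j with h.val ≠ i, (m j).ν h t

/-- `s^{-i}_t` -/
def sAvg (m : Profile G φ τ κ) (i : ι) (t : τ) : ℝ :=
  (∑ j ∈ G.neighborFinset i, ((m j).s t : ℝ)) / (G.neighborFinset i).card

/-- `q^{-i,l}` -/
def qAvg (m : Profile G φ τ κ) (i : ι) (l : κ) : ℝ :=
  (∑ j ∈ G.neighborFinset i, ((m j).q l : ℝ)) / (G.neighborFinset i).card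

/-- `ζ^{-i}_t` -/
def zeta (m : Profile G φ τ κ) (i : ι) (t : τ) : ℝ :=
  (∑ j ∈ G.neighborFinset i, m.fPeak i j t) + m.helperProxy i t

/-- `z^{-i}` -/
def zPeak (m : Profile G φ τ κ) (i : ι) : ℝ := EnergyCommunity.peak (m.zeta i)

/-- The payment of user `i` for her allocation. -/
def cost (E : EnergyCommunity ι τ κ) (m : Profile G φ τ κ) (i : ι) : ℝ :=
  ∑ t, (E.price t + EnergyCommunity.radialPrice E.peakPrice (m.sAvg i) (m.zeta i) t) * m.alloc i t
    + ∑ l ∈ E.constraintsOf i, m.qAvg i l * ∑ t, E.a i l t * m.alloc i t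

/-- `con^{i,l}` -/
def conCon (E : EnergyCommunity ι τ κ) (m : Profile G φ τ κ) (i : ι) (l : κ) : ℝ :=
  ((m i).q l - m.qAvg i l) ^ 2
    + (m i).q l * (E.b l - ∑ j ∈ G.neighborFinset i, m.fCon E i j l
        - ∑ t, E.a i l t * m.helperProxy i t)

/-- `con^i_t` -/
def conPeak (m : Profile G φ τ κ) (i : ι) (t : τ) : ℝ :=
  ((m i).s t - m.sAvg i t) ^ 2 + (m i).s t * (m.zPeak i - m.zeta i t)

/-- The penalty for the summaries `n^{i,j,l}`. -/
def prN (E : EnergyCommunity ι τ κ) (m : Profile G φ τ κ) (i : ι) (l : κ) : ℝ :=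
  ∑ j : G.neighborSet i, ((m i).n j l - m.fCon E i j l) ^ 2

/-- The penalty for the proxies `β^{i,j}_t`. -/
def prBeta (m : Profile G φ τ κ) (i : ι) (t : τ) : ℝ :=
  ∑ j : {j : ι // φ j = i}, ((m i).β j t - (m j).y t) ^ 2

/-- The penalty for the summaries `ν^{i,j}_t`. -/
def prNu (m : Profile G φ τ κ) (i : ι) (t : τ) : ℝ :=
  ∑ j : G.neighborSet i, ((m i).ν j t - m.fPeak i j t) ^ 2

/-- The tax of user `i`. -/
def tax (E : EnergyCommunity ι τ κ) (m : Profile G φ τ κ) (i : ι) : ℝ :=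
  m.cost E i + ∑ l, (m.prN E i l + m.conCon E i l)
    + ∑ t, (m.prBeta i t + m.prNu i t + m.conPeak i t)

/-- The payoff of user `i` in the game induced by the mechanism. -/
def payoff (E : EnergyCommunity ι τ κ) (m : Profile G φ τ κ) (i : ι) : ℝ :=
  E.utility i (m.alloc i) - m.tax E i

/-- `m` is a (pure strategy) Nash equilibrium of the induced game. -/
def IsNash (E : EnergyCommunity ι τ κ) (m : Profile G φ τ κ) : Prop :=
  ∀ (i : ι) (mi : Message G φ τ κ i),
    payoff E (Function.update m i mi : Profile G φ τ κ) i ≤ payoff E m i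

end Profile

end

/-!
An allocation is optimal exactly if it is supported by prices: one for every constraint, and a
surcharge for every time slot that shares out the peak price, such that only binding constraints and
peak slots are priced and every user maximizes her utility net of her payment. The prices of an
optimal allocation are the Lagrange multipliers of the concave problem in which the peak is an
independent variable bounded below by the total demands.

In an equilibrium all proxies and summaries are exact, and along a tree exact summaries inform every
user of the true total demands. The price that a user quotes then is the average of her neighbours'
prices, lowered by half the slack and cut off at zero. A minimal price shows that the slack is
nonnegative, so no user quotes more than the average of her neighbours, and the maximum principle
makes the price constant; a constant price must vanish unless the slack does.
-/

section Farkas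

variable {𝕜 M J : Type*} [Field 𝕜] [LinearOrder 𝕜] [IsStrictOrderedRing 𝕜] [AddCommGroup M]
  [Module 𝕜 M]

theorem exists_apply_eq_one_of_not_forall_nonpos {s : Finset J} {k : J} {g : J → Module.Dual 𝕜 M}
    {c : Module.Dual 𝕜 M}
    (h : ∀ x, g k x ≤ 0 → (∀ j ∈ s, g j x ≤ 0) → c x ≤ 0)
    (hs : ¬ ∀ x, (∀ j ∈ s, g j x ≤ 0) → c x ≤ 0) :
    ∃ x, g k x = 1 ∧ (∀ j ∈ s, g j x ≤ 0) ∧ 0 ≤ c x := by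
  push Not at hs
  obtain ⟨x, hgx, hcx⟩ := hs
  have hkx : 0 < g k x := not_le.1 fun hk => hcx.not_ge (h x hk hgx)
  refine ⟨(g k x)⁻¹ • x, by simp [hkx.ne'], fun j hj => ?_, ?_⟩
  · simpa using mul_nonpos_of_nonneg_of_nonpos (inv_nonneg.2 hkx.le) (hgx j hj)
  · simpa using mul_nonneg (inv_nonneg.2 hkx.le) hcx.le

theorem mem_hull_image_of_forall_nonpos (s : Finset J) (g : J → Module.Dual 𝕜 M)
    (c : Module.Dual 𝕜 M) (h : ∀ x, (∀ j ∈ s, g j x ≤ 0) → c x ≤ 0) :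
    c ∈ PointedCone.hull 𝕜 (g '' s) := by
  classical
  induction s using Finset.induction_on generalizing g c with
  | empty =>
    suffices c = 0 by simp [this]
    ext x
    have hneg : c (-x) ≤ 0 := h (-x) (by simp)
    exact le_antisymm (h x (by simp)) (by simpa using hneg)
  | insert k s _ ih =>
    simp only [Finset.forall_mem_insert, and_imp] at h
    rw [Finset.coe_insert, Set.image_insert_eq]
    by_cases hs : ∀ x, (∀ j ∈ s, g j x ≤ 0) → c x ≤ 0
    · exact Submodule.span_mono (Set.subset_insert _ _) (ih g c hs)
    obtain ⟨x₀, hk, hgx₀, hcx₀⟩ := exists_apply_eq_one_of_not_forall_nonpos h hs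
    -- Projecting along `x₀` onto the kernel of `g k` eliminates the constraint `g k`.
    have hproj : c - c x₀ • g k ∈ PointedCone.hull 𝕜 ((fun j => g j - g j x₀ • g k) '' s) := by
      refine ih _ _ fun x hx => ?_
      have := h (x - g k x • x₀) (by simp [hk]) fun j hj => by
        simpa [mul_comm] using hx j hj
      simpa [mul_comm] using this
    have hmem_k : g k ∈ PointedCone.hull 𝕜 (insert (g k) (g '' s)) :=
      Submodule.subset_span (Set.mem_insert _ _)
    have hle : PointedCone.hull 𝕜 ((fun j => g j - g j x₀ • g k) '' s)
        ≤ PointedCone.hull 𝕜 (insert (g k) (g '' s)) := by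
      refine Submodule.span_le.2 (Set.image_subset_iff.2 fun j hj => ?_)
      have hmem_j : g j ∈ PointedCone.hull 𝕜 (insert (g k) (g '' s)) :=
        Submodule.subset_span (Set.mem_insert_of_mem _ ⟨j, hj, rfl⟩)
      have hcoeff : 0 ≤ -g j x₀ := neg_nonneg.2 (hgx₀ j hj)
      simpa [sub_eq_add_neg] using add_mem hmem_j (PointedCone.smul_mem _ hcoeff hmem_k)
    simpa using add_mem (hle hproj) (PointedCone.smul_mem _ hcx₀ hmem_k)

end Farkas

section Lagrange

variable {M J : Type*} [AddCommGroup M] [Module ℝ M]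

theorem exists_pos_forall_apply_add_smul_le [Finite J] (g : J → Module.Dual ℝ M) (b : J → ℝ)
    (x δ : M) (hx : ∀ j, g j x ≤ b j) (hδ : ∀ j, g j x = b j → g j δ ≤ 0) :
    ∃ ε > (0 : ℝ), ∀ j, g j (x + ε • δ) ≤ b j := by
  suffices h : ∀ᶠ ε in nhdsWithin (0 : ℝ) (Set.Ioi 0), ∀ j, g j (x + ε • δ) ≤ b j by
    obtain ⟨ε, hε, hpos⟩ := (h.and self_mem_nhdsWithin).exists
    exact ⟨ε, hpos, hε⟩
  refine Filter.eventually_all.2 fun j => ?_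
  simp only [map_add, map_smul, smul_eq_mul]
  rcases (hx j).eq_or_lt with hactive | hslack
  · filter_upwards [self_mem_nhdsWithin] with ε hε
    have := mul_nonpos_of_nonneg_of_nonpos (le_of_lt hε) (hδ j hactive)
    linarith
  · have hcont : ContinuousAt (fun ε : ℝ => g j x + ε * g j δ) 0 := by fun_prop
    exact ((hcont.eventually_lt continuousAt_const (by simpa using hslack)).mono
      fun _ => le_of_lt).filter_mono nhdsWithin_le_nhds

theorem exists_multipliers_of_isMaxOn_dual [Fintype J] {c : Module.Dual ℝ M}
    {g : J → Module.Dual ℝ M} {b : J → ℝ} {x : M} (hx : ∀ j, g j x ≤ b j)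
    (hmax : IsMaxOn c {y | ∀ j, g j y ≤ b j} x) :
    ∃ r : J → ℝ, (∀ j, 0 ≤ r j) ∧ (∀ j, r j * (b j - g j x) = 0) ∧ c = ∑ j, r j • g j := by
  classical
  let active : Finset J := {j | g j x = b j}
  have hcone : c ∈ PointedCone.hull ℝ (g '' active) := by
    refine mem_hull_image_of_forall_nonpos active g c fun δ hδ => ?_
    obtain ⟨ε, hε, hfeas⟩ := exists_pos_forall_apply_add_smul_le g b x δ hx fun j hj =>
      hδ j (by simpa [active] using hj)
    have hle : c (x + ε • δ) ≤ c x := hmax hfeas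
    rw [map_add, map_smul, smul_eq_mul, add_le_iff_nonpos_right] at hle
    exact nonpos_of_mul_nonpos_right hle hε
  obtain ⟨r, hr⟩ := (Submodule.mem_span_image_finset_iff_exists_fun' _).1 hcone
  refine ⟨fun j => if j ∈ active then r j else 0, fun j => ?_, fun j => ?_, ?_⟩
  · dsimp only
    split_ifs
    exacts [(r j).2, le_rfl]
  · by_cases hj : j ∈ active
    · have hactive : g j x = b j := by simpa [active] using hj
      simp [hactive]
    · simp [hj]
  · simp only [ite_smul, zero_smul, Finset.sum_ite_mem, Finset.univ_inter]
    exact hr.symm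

variable [TopologicalSpace M] [IsTopologicalAddGroup M] [ContinuousSMul ℝ M]

theorem exists_separating_hyperplane_of_isMaxOn {f : M → ℝ} (hf : ConcaveOn ℝ Set.univ f)
    (hcont : Continuous f) {X : Set M} (hX : Convex ℝ X) {x : M} (hx : x ∈ X)
    (hmax : IsMaxOn f X x) :
    ∃ (L : StrongDual ℝ M) (α : ℝ), 0 < α ∧ ∀ y, ∀ x' ∈ X, L y + f y * α ≤ L x' + f x * α := by
  let A : Set (M × ℝ) := {p | p.2 < f p.1}
  have hA : Convex ℝ A := by simpa [A] using hf.convex_strict_hypograph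
  have hAo : IsOpen A := isOpen_lt continuous_snd (hcont.comp continuous_fst)
  have hdisj : Disjoint A (X ×ˢ {f x}) := by
    rw [Set.disjoint_left]
    rintro ⟨y, r⟩ hy ⟨hyX, rfl⟩
    exact (isMaxOn_iff.1 hmax y hyX).not_gt hy
  obtain ⟨ψ, u, hψA, hψX⟩ :=
    geometric_hahn_banach_open hA hAo (hX.prod (convex_singleton (f x))) hdisj
  let L : StrongDual ℝ M := ψ.comp (.inl ℝ M ℝ)
  let α : ℝ := ψ (0, 1)
  have hψ : ∀ y r, ψ (y, r) = L y + r * α := fun y r => by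
    rw [← smul_eq_mul, ← map_smul, ContinuousLinearMap.comp_apply, ← map_add]
    simp
  have hbelow : ∀ y r, r < f y → L y + r * α < u := fun y r h => hψ y r ▸ hψA (y, r) h
  have habove : ∀ y ∈ X, u ≤ L y + f x * α := fun y hy => hψ y (f x) ▸ hψX (y, f x) ⟨hy, rfl⟩
  have hα : 0 < α := by linarith [hbelow x (f x - 1) (by linarith), habove x hx]
  refine ⟨L, α, hα, fun y x' hx' => le_trans (le_of_not_gt fun hlt => ?_) (habove x' hx')⟩
  have := hbelow y ((u - L y) / α) (by rwa [div_lt_iff₀ hα, sub_lt_iff_lt_add'])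
  rw [div_mul_cancel₀ _ hα.ne'] at this
  linarith

theorem exists_supergradient_of_isMaxOn {f : M → ℝ} (hf : ConcaveOn ℝ Set.univ f)
    (hcont : Continuous f) {X : Set M} (hX : Convex ℝ X) {x : M} (hx : x ∈ X)
    (hmax : IsMaxOn f X x) :
    ∃ c : StrongDual ℝ M, (∀ y, f y ≤ f x + c (y - x)) ∧ IsMaxOn c X x := by
  obtain ⟨L, α, hα, hL⟩ := exists_separating_hyperplane_of_isMaxOn hf hcont hX hx hmax
  refine ⟨-(α⁻¹ • L), fun y => ?_, fun y hy => ?_⟩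
  · have : f y ≤ f x - α⁻¹ * (L y - L x) := by
      field_simp
      linarith [hL y x hx]
    simpa [mul_sub, sub_eq_add_neg, add_comm] using this
  · have : L x ≤ L y := by linarith [hL x y hy]
    simpa using mul_le_mul_of_nonneg_left this (inv_nonneg.2 hα.le)

theorem exists_lagrange_multipliers_of_isMaxOn [Fintype J] {f : M → ℝ} (hf : ConcaveOn ℝ Set.univ f)
    (hcont : Continuous f) {g : J → Module.Dual ℝ M} {b : J → ℝ} {x : M}
    (hx : ∀ j, g j x ≤ b j) (hmax : IsMaxOn f {y | ∀ j, g j y ≤ b j} x) :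
    ∃ r : J → ℝ, (∀ j, 0 ≤ r j) ∧ (∀ j, r j * (b j - g j x) = 0) ∧
      ∀ y, f y - ∑ j, r j * g j y ≤ f x - ∑ j, r j * g j x := by
  have hconv : Convex ℝ {y | ∀ j, g j y ≤ b j} := by
    rw [Set.ofPred_forall]
    exact convex_iInter fun j => convex_halfSpace_le (g j).isLinear (b j)
  obtain ⟨c, hc, hcmax⟩ := exists_supergradient_of_isMaxOn hf hcont hconv hx hmax
  obtain ⟨r, hr, hslack, hcr⟩ := exists_multipliers_of_isMaxOn_dual (c := c.toLinearMap) hx hcmax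
  refine ⟨r, hr, hslack, fun y => ?_⟩
  have hsum : ∀ y, c y = ∑ j, r j * g j y := fun y => by
    simpa [LinearMap.sum_apply] using LinearMap.congr_fun hcr y
  have := hc y
  rw [map_sub, hsum, hsum] at this
  linarith

end Lagrange

theorem concaveOn_sum {ι M : Type*} [AddCommGroup M] [Module ℝ M] {s : Set M} (hs : Convex ℝ s)
    {f : ι → M → ℝ} (u : Finset ι) (hf : ∀ i ∈ u, ConcaveOn ℝ s (f i)) :
    ConcaveOn ℝ s (∑ i ∈ u, f i) :=
  Finset.sum_induction f (ConcaveOn ℝ s) (fun _ _ => ConcaveOn.add) (concaveOn_const 0 hs) hf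

theorem strictConcaveOn_sum_apply {ι : Type*} [Fintype ι] {M : ι → Type*}
    [∀ i, AddCommGroup (M i)] [∀ i, Module ℝ (M i)] {s : ∀ i, Set (M i)} {f : ∀ i, M i → ℝ}
    (hf : ∀ i, StrictConcaveOn ℝ (s i) (f i)) :
    StrictConcaveOn ℝ (Set.univ.pi s) fun x : ∀ i, M i => ∑ i, f i (x i) := by
  refine ⟨convex_pi fun i _ => (hf i).1, fun x hx y hy hxy α β hα hβ hαβ => ?_⟩
  obtain ⟨i₀, hi₀⟩ := Function.ne_iff.1 hxy
  simp only [smul_eq_mul, Finset.mul_sum, ← Finset.sum_add_distrib]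
  refine Finset.sum_lt_sum (fun i _ => ?_) ⟨i₀, Finset.mem_univ _, ?_⟩
  · exact (hf i).concaveOn.2 (hx i trivial) (hy i trivial) hα.le hβ.le hαβ
  · exact (hf i₀).2 (hx i₀ trivial) (hy i₀ trivial) hi₀ hα hβ hαβ

namespace EnergyCommunity

section Peak

variable {τ : Type*} [Fintype τ] [Nonempty τ]

theorem le_peak (d : τ → ℝ) (t : τ) : d t ≤ peak d :=
  Finset.le_sup' d (Finset.mem_univ t)

theorem peak_le {d : τ → ℝ} {z : ℝ} (h : ∀ t, d t ≤ z) : peak d ≤ z :=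
  Finset.sup'_le _ _ fun t _ => h t

theorem exists_eq_peak (d : τ → ℝ) : ∃ t, d t = peak d := by
  obtain ⟨t, -, ht⟩ := Finset.exists_mem_eq_sup' (Finset.univ_nonempty (α := τ)) d
  exact ⟨t, ht.symm⟩

theorem convexOn_peak : ConvexOn ℝ Set.univ (peak : (τ → ℝ) → ℝ) :=
  ⟨convex_univ, fun d _ e _ _ _ hα hβ _ => peak_le fun t =>
    add_le_add (mul_le_mul_of_nonneg_left (le_peak d t) hα)
      (mul_le_mul_of_nonneg_left (le_peak e t) hβ)⟩

end Peak

section RadialPrice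

variable {τ : Type*} [Fintype τ] [Nonempty τ]

theorem radialPrice_nonneg {p₀ : ℝ} (hp : 0 ≤ p₀) {s : τ → ℝ} (hs : 0 ≤ s) (d : τ → ℝ) (t : τ) :
    0 ≤ radialPrice p₀ s d t := by
  unfold radialPrice
  split_ifs
  · exact mul_nonneg (div_nonneg (hs t) (Finset.sum_nonneg fun t _ => hs t)) hp
  · positivity
  · exact le_rfl

theorem sum_radialPrice (p₀ : ℝ) {s : τ → ℝ} (hs : 0 ≤ s) (d : τ → ℝ) :
    ∑ t, radialPrice p₀ s d t = p₀ := by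
  classical
  unfold radialPrice
  split_ifs with h
  · have hsum : ∑ t, s t ≠ 0 := mt (Fintype.sum_eq_zero_iff_of_nonneg hs).1 h
    rw [← Finset.sum_mul, ← Finset.sum_div, div_self hsum, one_mul]
  · obtain ⟨t, ht⟩ := exists_eq_peak d
    have hcard : ((Finset.univ.filter fun t' => d t' = peak d).card : ℝ) ≠ 0 :=
      Nat.cast_ne_zero.2 (Finset.card_ne_zero_of_mem (a := t) (by simpa using ht))
    rw [← Finset.sum_filter, Finset.sum_const, nsmul_eq_mul]
    convert mul_div_cancel₀ p₀ hcard

theorem radialPrice_mul_peak_sub (p₀ : ℝ) {s d : τ → ℝ} (h : ∀ t, s t * (peak d - d t) = 0)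
    (t : τ) : radialPrice p₀ s d t * (peak d - d t) = 0 := by
  unfold radialPrice
  split_ifs with hs hd
  · rw [div_mul_eq_mul_div, div_mul_eq_mul_div, mul_right_comm, h t, zero_mul, zero_div]
  · rw [hd, sub_self, mul_zero]
  · exact zero_mul _

theorem radialPrice_sum_self {s : τ → ℝ} (hs : 0 ≤ s) (d : τ → ℝ) :
    radialPrice (∑ t, s t) s d = s := by
  funext t
  by_cases h : s = 0
  · simp [radialPrice, h]
  · have hsum : ∑ t, s t ≠ 0 := mt (Fintype.sum_eq_zero_iff_of_nonneg hs).1 h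
    simp [radialPrice, h, hsum]

end RadialPrice

section Optimum

variable {ι τ κ : Type*} [Fintype ι] [Fintype τ] {E : EnergyCommunity ι τ κ}

theorem strictConcaveOn_sum_utility (hconc : ∀ i t, StrictConcaveOn ℝ Set.univ (E.v i t)) :
    StrictConcaveOn ℝ Set.univ fun x : ι → τ → ℝ => ∑ i, E.utility i (x i) := by
  have h := strictConcaveOn_sum_apply fun i => strictConcaveOn_sum_apply (hconc i)
  simp only [Set.pi_univ] at h
  exact h

theorem convex_feasible : Convex ℝ E.feasible := by
  intro x hx y hy α β hα hβ hαβ l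
  calc ∑ i, ∑ t, E.a i l t * (α • x + β • y) i t
      = α * ∑ i, ∑ t, E.a i l t * x i t + β * ∑ i, ∑ t, E.a i l t * y i t := by
        simp only [Pi.add_apply, Pi.smul_apply, smul_eq_mul, mul_add, Finset.sum_add_distrib,
          Finset.mul_sum, mul_left_comm]
    _ ≤ α * E.b l + β * E.b l := by gcongr; exacts [hx l, hy l]
    _ = E.b l := by rw [← add_mul, hαβ, one_mul]

theorem isClosed_feasible : IsClosed E.feasible := by
  rw [feasible, Set.ofPred_forall]
  exact isClosed_iInter fun l => isClosed_le (by fun_prop) continuous_const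

variable [Nonempty τ]

theorem convexOn_energyCost (hp : 0 ≤ E.peakPrice) : ConvexOn ℝ Set.univ E.energyCost := by
  have hlin : ConvexOn ℝ Set.univ fun d : τ → ℝ => ∑ t, E.price t * d t :=
    (Fintype.linearCombination ℝ E.price).convexOn convex_univ |>.congr fun d _ => by
      simp [Fintype.linearCombination_apply, mul_comm]
  have hcost := (hlin.add (convexOn_peak.smul hp)).comp_linearMap
    (∑ i, LinearMap.proj i : (ι → τ → ℝ) →ₗ[ℝ] τ → ℝ)
  exact hcost.congr fun x _ => by simp [energyCost, Finset.sum_fn]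

theorem strictConcaveOn_welfare (hconc : ∀ i t, StrictConcaveOn ℝ Set.univ (E.v i t))
    (hp : 0 ≤ E.peakPrice) : StrictConcaveOn ℝ Set.univ E.welfare :=
  (strictConcaveOn_sum_utility hconc).sub_convexOn (convexOn_energyCost hp)

theorem existsUnique_isOptimalAllocation (hconc : ∀ i t, StrictConcaveOn ℝ Set.univ (E.v i t))
    (hp : 0 ≤ E.peakPrice) (hne : E.feasible.Nonempty) (hbdd : Bornology.IsBounded E.feasible) :
    ∃! x, E.IsOptimalAllocation x := by
  have hwelfare := strictConcaveOn_welfare hconc hp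
  have hcont : ContinuousOn E.welfare Set.univ := hwelfare.concaveOn.continuousOn isOpen_univ
  obtain ⟨x, hx, hmax⟩ :=
    (Metric.isCompact_of_isClosed_isBounded isClosed_feasible hbdd).exists_isMaxOn hne
      (hcont.mono (Set.subset_univ _))
  exact ⟨x, ⟨hx, hmax⟩, fun y hy =>
    (hwelfare.subset (Set.subset_univ _) convex_feasible).eq_of_isMaxOn hy.2 hmax hy.1 hx⟩

end Optimum

section Epigraph

variable {ι τ κ : Type*} {E : EnergyCommunity ι τ κ}

/-- The demand of user `i` at time `t` as a linear functional on the domain of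
`epigraphWelfare`. -/
def demand (i : ι) (t : τ) : Module.Dual ℝ ((ι → τ → ℝ) × ℝ) :=
  LinearMap.proj t ∘ₗ LinearMap.proj i ∘ₗ LinearMap.fst ℝ (ι → τ → ℝ) ℝ

@[simp]
theorem demand_apply (i : ι) (t : τ) (p : (ι → τ → ℝ) × ℝ) : demand i t p = p.1 i t :=
  rfl

variable [Fintype ι] [Fintype τ]

/-- Welfare in epigraph form: the peak is replaced by an independent variable, which makes the
objective additive over the users. -/
noncomputable def epigraphWelfare (E : EnergyCommunity ι τ κ) (p : (ι → τ → ℝ) × ℝ) : ℝ :=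
  ∑ i, E.utility i (p.1 i) - ∑ t, E.price t * ∑ i, p.1 i t - E.peakPrice * p.2

theorem concaveOn_epigraphWelfare (hconc : ∀ i t, ConcaveOn ℝ Set.univ (E.v i t)) :
    ConcaveOn ℝ Set.univ E.epigraphWelfare := by
  have hutility := concaveOn_sum convex_univ Finset.univ fun i _ =>
    concaveOn_sum convex_univ Finset.univ fun t _ => (hconc i t).comp_linearMap (demand i t)
  let cost : Module.Dual ℝ ((ι → τ → ℝ) × ℝ) :=
    ∑ t, E.price t • ∑ i, demand i t + E.peakPrice • LinearMap.snd ℝ _ _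
  exact (hutility.sub (cost.convexOn convex_univ)).congr fun p _ => by
    simp [cost, epigraphWelfare, utility, LinearMap.sum_apply, sub_sub]

theorem IsOptimalAllocation.epigraphWelfare_le [Nonempty τ] (hp : 0 ≤ E.peakPrice)
    {x : ι → τ → ℝ} (hx : E.IsOptimalAllocation x) {p : (ι → τ → ℝ) × ℝ} (hfeas : p.1 ∈ E.feasible)
    (hpeak : ∀ t, ∑ i, p.1 i t ≤ p.2) :
    E.epigraphWelfare p ≤ E.epigraphWelfare (x, peak fun t => ∑ i, x i t) := by
  have hwelfare := hx.2 p.1 hfeas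
  have hpeak_le := mul_le_mul_of_nonneg_left (peak_le hpeak) hp
  simp only [welfare, energyCost, epigraphWelfare] at hwelfare ⊢
  linarith

/-- The linear constraints of the welfare problem in epigraph form, bounded above by
`Sum.elim E.b 0`. -/
def epigraphConstraint (E : EnergyCommunity ι τ κ) :
    κ ⊕ τ → Module.Dual ℝ ((ι → τ → ℝ) × ℝ) :=
  Sum.elim (fun l => ∑ i, ∑ t, E.a i l t • demand i t)
    (fun t => ∑ i, demand i t - LinearMap.snd ℝ _ _)

theorem epigraphConstraint_inl (l : κ) (p : (ι → τ → ℝ) × ℝ) :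
    E.epigraphConstraint (.inl l) p = ∑ i, ∑ t, E.a i l t * p.1 i t := by
  simp [epigraphConstraint, LinearMap.sum_apply]

theorem epigraphConstraint_inr (t : τ) (p : (ι → τ → ℝ) × ℝ) :
    E.epigraphConstraint (.inr t) p = ∑ i, p.1 i t - p.2 := by
  simp [epigraphConstraint, LinearMap.sum_apply]

end Epigraph

section SupportingPrices

variable {ι τ κ : Type*} [Fintype τ] [Fintype κ] {E : EnergyCommunity ι τ κ}

/-- The utility that user `i` derives from the demand `y`, net of her payment, when the peak
surcharges are `r` and the constraints have prices `q`. -/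
noncomputable def netUtility (E : EnergyCommunity ι τ κ) (i : ι) (q : κ → ℝ) (r : τ → ℝ)
    (y : τ → ℝ) : ℝ :=
  E.utility i y - (∑ t, (E.price t + r t) * y t + ∑ l, q l * ∑ t, E.a i l t * y t)

theorem sum_constraintsOf (i : ι) (q : κ → ℝ) (y : τ → ℝ) :
    ∑ l ∈ E.constraintsOf i, q l * ∑ t, E.a i l t * y t = ∑ l, q l * ∑ t, E.a i l t * y t := by
  refine Finset.sum_subset (Finset.subset_univ _) fun l _ hl => ?_
  have : E.a i l = 0 := by simpa [constraintsOf] using hl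
  simp [this]

variable [Fintype ι]

theorem sum_netUtility (q : κ → ℝ) (r : τ → ℝ) (x : ι → τ → ℝ) :
    ∑ i, E.netUtility i q r (x i) = ∑ i, E.utility i (x i) - ∑ t, E.price t * ∑ i, x i t
      - ∑ t, r t * ∑ i, x i t - ∑ l, q l * ∑ i, ∑ t, E.a i l t * x i t := by
  simp only [netUtility, Finset.sum_sub_distrib, Finset.sum_add_distrib, add_mul]
  rw [Finset.sum_comm (f := fun i t => E.price t * x i t),
    Finset.sum_comm (f := fun i t => r t * x i t),
    Finset.sum_comm (f := fun i l => q l * ∑ t, E.a i l t * x i t)]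
  simp only [← Finset.mul_sum]
  ring

theorem epigraphWelfare_sub_sum (q : κ → ℝ) (r : τ → ℝ) (p : (ι → τ → ℝ) × ℝ) :
    E.epigraphWelfare p - ∑ j, Sum.elim q r j * E.epigraphConstraint j p
      = ∑ i, E.netUtility i q r (p.1 i) + (∑ t, r t - E.peakPrice) * p.2 := by
  rw [sum_netUtility, Fintype.sum_sum_type, epigraphWelfare]
  simp only [Sum.elim_inl, Sum.elim_inr, epigraphConstraint_inl, epigraphConstraint_inr, mul_sub,
    Finset.sum_sub_distrib, ← Finset.sum_mul]
  ring

variable [Nonempty τ]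

/-- The feasible allocation `x` is a competitive equilibrium at the constraint prices `q` and the
peak surcharges `r`: the surcharges share out the peak price, only binding constraints and peak
slots are priced, and no user wants to change her demand. -/
structure IsSupportedBy (E : EnergyCommunity ι τ κ) (x : ι → τ → ℝ) (q : κ → ℝ) (r : τ → ℝ) :
    Prop where
  feasible : x ∈ E.feasible
  q_nonneg : ∀ l, 0 ≤ q l
  r_nonneg : ∀ t, 0 ≤ r t
  q_mul_slack : ∀ l, q l * (E.b l - ∑ i, ∑ t, E.a i l t * x i t) = 0
  r_mul_slack : ∀ t, r t * (peak (fun t => ∑ i, x i t) - ∑ i, x i t) = 0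
  sum_r : ∑ t, r t = E.peakPrice
  netUtility_le : ∀ i y, E.netUtility i q r y ≤ E.netUtility i q r (x i)

theorem IsSupportedBy.isOptimalAllocation {x : ι → τ → ℝ} {q : κ → ℝ} {r : τ → ℝ}
    (h : E.IsSupportedBy x q r) : E.IsOptimalAllocation x := by
  refine ⟨h.feasible, fun x' hx' => ?_⟩
  have hnet : ∑ i, E.netUtility i q r (x' i) ≤ ∑ i, E.netUtility i q r (x i) :=
    Finset.sum_le_sum fun i _ => h.netUtility_le i (x' i)
  have hcon : ∑ l, q l * ∑ i, ∑ t, E.a i l t * x' i t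
      ≤ ∑ l, q l * ∑ i, ∑ t, E.a i l t * x i t := by
    refine Finset.sum_le_sum fun l _ => ?_
    have := mul_le_mul_of_nonneg_left (hx' l) (h.q_nonneg l)
    linarith [h.q_mul_slack l]
  have hpeak_le : ∑ t, r t * ∑ i, x' i t ≤ E.peakPrice * peak (fun t => ∑ i, x' i t) := by
    rw [← h.sum_r, Finset.sum_mul]
    exact Finset.sum_le_sum fun t _ =>
      mul_le_mul_of_nonneg_left (le_peak (fun t => ∑ i, x' i t) t) (h.r_nonneg t)
  have hpeak_eq : ∑ t, r t * ∑ i, x i t = E.peakPrice * peak (fun t => ∑ i, x i t) := by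
    rw [← h.sum_r, Finset.sum_mul]
    exact Finset.sum_congr rfl fun t _ => by linarith [h.r_mul_slack t]
  rw [sum_netUtility, sum_netUtility] at hnet
  simp only [welfare, energyCost]
  linarith

theorem IsOptimalAllocation.exists_multipliers (hconc : ∀ i t, ConcaveOn ℝ Set.univ (E.v i t))
    (hp : 0 ≤ E.peakPrice) {x : ι → τ → ℝ} (hx : E.IsOptimalAllocation x) :
    ∃ (q : κ → ℝ) (r : τ → ℝ), (∀ l, 0 ≤ q l) ∧ (∀ t, 0 ≤ r t) ∧
      (∀ l, q l * (E.b l - ∑ i, ∑ t, E.a i l t * x i t) = 0) ∧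
      (∀ t, r t * (peak (fun t => ∑ i, x i t) - ∑ i, x i t) = 0) ∧
      ∀ (y : ι → τ → ℝ) z, ∑ i, E.netUtility i q r (y i) + (∑ t, r t - E.peakPrice) * z
        ≤ ∑ i, E.netUtility i q r (x i)
          + (∑ t, r t - E.peakPrice) * peak fun t => ∑ i, x i t := by
  have hconcave := concaveOn_epigraphWelfare hconc
  have hcont : Continuous E.epigraphWelfare :=
    continuousOn_univ.1 (hconcave.continuousOn isOpen_univ)
  obtain ⟨m, hm, hslack, hmax⟩ := exists_lagrange_multipliers_of_isMaxOn hconcave hcont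
    (g := E.epigraphConstraint) (b := Sum.elim E.b 0) (x := (x, peak fun t => ∑ i, x i t))
    (Sum.forall.2 ⟨fun l => by simpa [epigraphConstraint_inl] using hx.1 l,
      fun t => by simpa [epigraphConstraint_inr] using le_peak (fun t => ∑ i, x i t) t⟩)
    (fun p hpfeas => hx.epigraphWelfare_le hp
      (fun l => by simpa [epigraphConstraint_inl] using hpfeas (.inl l))
      (fun t => by simpa [epigraphConstraint_inr] using hpfeas (.inr t)))
  refine ⟨fun l => m (.inl l), fun t => m (.inr t), fun l => hm _, fun t => hm _, fun l => ?_,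
    fun t => ?_, fun y z => ?_⟩
  · simpa [epigraphConstraint_inl] using hslack (.inl l)
  · simpa [epigraphConstraint_inr] using hslack (.inr t)
  · have := hmax (y, z)
    rw [← Sum.elim_comp_inl_inr m, epigraphWelfare_sub_sum, epigraphWelfare_sub_sum] at this
    exact this

theorem IsOptimalAllocation.exists_isSupportedBy
    (hconc : ∀ i t, ConcaveOn ℝ Set.univ (E.v i t)) (hp : 0 ≤ E.peakPrice) {x : ι → τ → ℝ}
    (hx : E.IsOptimalAllocation x) : ∃ q r, E.IsSupportedBy x q r := by
  classical
  obtain ⟨q, r, hq, hr, hq_slack, hr_slack, hmax⟩ := hx.exists_multipliers hconc hp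
  have hsum : ∑ t, r t = E.peakPrice := by
    have hup := hmax x (peak (fun t => ∑ i, x i t) + 1)
    have hdown := hmax x (peak (fun t => ∑ i, x i t) - 1)
    linarith
  refine ⟨q, r, hx.1, hq, hr, hq_slack, hr_slack, hsum, fun i y => ?_⟩
  have hdev := hmax (Function.update x i y) (peak fun t => ∑ i, x i t)
  rw [← Finset.add_sum_erase _ _ (Finset.mem_univ i),
    ← Finset.add_sum_erase _ (fun i => E.netUtility i q r (x i)) (Finset.mem_univ i),
    Finset.sum_congr rfl fun j hj => by rw [Function.update_of_ne (Finset.ne_of_mem_erase hj)],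
    Function.update_self] at hdev
  linarith

end SupportingPrices

end EnergyCommunity

section NeighborAvg

variable {V : Type*} {G : SimpleGraph V}

theorem forall_of_connected_of_adj (hG : G.Connected) {p : V → Prop}
    (hadj : ∀ i j, G.Adj i j → p i → p j) {i : V} (hi : p i) (j : V) : p j := by
  induction (G.reachable_iff_reflTransGen i j).1 (hG.preconnected i j) with
  | refl => exact hi
  | tail _ hjk ih => exact hadj _ _ hjk ih

/-- The mean value of `q` over the neighbours of `i`, which is `0` if there are none. -/
noncomputable def neighborAvg (G : SimpleGraph V) [G.LocallyFinite] (q : V → ℝ) (i : V) : ℝ :=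
  (∑ j ∈ G.neighborFinset i, q j) / (G.neighborFinset i).card

variable [G.LocallyFinite]

theorem le_neighborAvg_iff {q : V → ℝ} {c : ℝ} {i j : V} (hij : G.Adj i j) :
    c ≤ neighborAvg G q i ↔ 0 ≤ ∑ j ∈ G.neighborFinset i, (q j - c) := by
  have hcard : (0 : ℝ) < (G.neighborFinset i).card :=
    Nat.cast_pos.2 (Finset.card_pos.2 ⟨j, (G.mem_neighborFinset i j).2 hij⟩)
  rw [neighborAvg, le_div_iff₀ hcard, Finset.sum_sub_distrib, Finset.sum_const, nsmul_eq_mul,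
    sub_nonneg, mul_comm]

theorem le_neighborAvg {q : V → ℝ} {c : ℝ} (hq : ∀ j, c ≤ q j) {i j : V} (hij : G.Adj i j) :
    c ≤ neighborAvg G q i :=
  (le_neighborAvg_iff hij).2 (Finset.sum_nonneg fun j _ => sub_nonneg.2 (hq j))

theorem neighborAvg_eq_of_forall_eq {q : V → ℝ} {c : ℝ} (hq : ∀ j, q j = c) {i j : V}
    (hij : G.Adj i j) : neighborAvg G q i = c := by
  have hcard : ((G.neighborFinset i).card : ℝ) ≠ 0 :=
    Nat.cast_ne_zero.2 (Finset.card_ne_zero_of_mem ((G.mem_neighborFinset i j).2 hij))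
  simp only [neighborAvg, hq, Finset.sum_const, nsmul_eq_mul]
  exact mul_div_cancel_left₀ c hcard

theorem exists_forall_eq_of_le_neighborAvg [Finite V] (hG : G.Connected) {q : V → ℝ}
    (h : ∀ i, q i ≤ neighborAvg G q i) : ∃ c, ∀ i, q i = c := by
  have := hG.nonempty
  obtain ⟨k, hk⟩ := Finite.exists_max q
  refine ⟨q k, forall_of_connected_of_adj hG (fun i j hij hi => ?_) rfl⟩
  have havg : 0 ≤ ∑ j ∈ G.neighborFinset i, (q j - q k) :=
    (le_neighborAvg_iff hij).1 (hi ▸ h i)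
  have hzero := (Finset.sum_eq_zero_iff_of_nonpos fun j _ => sub_nonpos.2 (hk j)).1
    (havg.antisymm' (Finset.sum_nonpos fun j _ => sub_nonpos.2 (hk j)))
  exact sub_eq_zero.1 (hzero j ((G.mem_neighborFinset i j).2 hij))

theorem eq_toNNReal_coe_sub_iff {c : ℝ≥0} {w : ℝ} :
    c = (c - w : ℝ).toNNReal ↔ 0 ≤ w ∧ c * w = 0 := by
  have := c.coe_nonneg
  rw [← NNReal.coe_inj, Real.coe_toNNReal']
  rcases max_cases (c - w : ℝ) 0 with ⟨hmax, _⟩ | ⟨hmax, _⟩ <;> rw [hmax] <;> constructor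
  · intro h
    have : w = 0 := by linarith
    exact ⟨this.ge, by rw [this, mul_zero]⟩
  · rintro ⟨_, hcw⟩
    rcases mul_eq_zero.1 hcw <;> linarith
  · intro h
    exact ⟨by linarith, by rw [h, zero_mul]⟩
  · rintro ⟨_, hcw⟩
    rcases mul_eq_zero.1 hcw <;> linarith

theorem forall_eq_toNNReal_neighborAvg_sub_iff [Finite V] (hG : G.Connected)
    (hnbr : ∀ i, ∃ j, G.Adj i j) {q : V → ℝ≥0} {w : ℝ} :
    (∀ i, q i = (neighborAvg G (fun j => q j) i - w).toNNReal) ↔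
      ∃ c : ℝ≥0, (∀ i, q i = c) ∧ 0 ≤ w ∧ c * w = 0 := by
  have havg_const : ∀ {c}, (∀ i, q i = c) → ∀ i, neighborAvg G (fun j => q j) i = c :=
    fun hc i => (hnbr i).elim fun _ => neighborAvg_eq_of_forall_eq fun j =>
      congrArg NNReal.toReal (hc j)
  refine ⟨fun h => ?_, fun ⟨c, hc, hcw⟩ i => ?_⟩
  · have := hG.nonempty
    have hw : 0 ≤ w := by
      obtain ⟨k, hk⟩ := Finite.exists_min q
      obtain ⟨j, hkj⟩ := hnbr k
      have hfixed := Real.le_coe_toNNReal (neighborAvg G (fun j => q j) k - w)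
      rw [← h k] at hfixed
      linarith [le_neighborAvg (fun i => NNReal.coe_le_coe.2 (hk i)) hkj]
    obtain ⟨c, hc⟩ := exists_forall_eq_of_le_neighborAvg hG (q := fun j => (q j : ℝ)) fun i => by
      obtain ⟨j, hij⟩ := hnbr i
      rw [h i, Real.coe_toNNReal']
      exact max_le (sub_le_self _ hw) (le_neighborAvg (fun j => (q j).coe_nonneg) hij)
    obtain ⟨i⟩ := hG.nonempty
    have hc' : ∀ j, q j = q i := fun j => NNReal.eq ((hc j).trans (hc i).symm)
    have hfixed := h i
    rw [havg_const hc'] at hfixed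
    exact ⟨q i, hc', eq_toNNReal_coe_sub_iff.1 hfixed⟩
  · rw [havg_const hc, hc i]
    exact eq_toNNReal_coe_sub_iff.2 hcw

end NeighborAvg

section TreeSummaries

variable {V : Type*} {G : SimpleGraph V}

theorem existsUnique_adj_dist_lt (hG : G.IsTree) {i k : V} (hki : k ≠ i) :
    ∃! j, G.Adj i j ∧ G.dist k j < G.dist k i := by
  obtain ⟨p, hp, hlength⟩ := hG.connected.exists_path_of_dist k i
  have hnil : ¬p.Nil := fun h => hki h.eq
  refine ⟨p.penultimate, ⟨(p.adj_penultimate hnil).symm, ?_⟩, fun j ⟨hij, _⟩ => ?_⟩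
  · have hle := G.dist_le p.dropLast
    have hpos := hG.connected.pos_dist_of_ne hki
    rw [SimpleGraph.Walk.length_dropLast] at hle
    omega
  · obtain ⟨p', hlength'⟩ := hG.connected.exists_walk_length_eq_dist k j
    have hpath : (p'.concat hij.symm).IsPath := by
      refine SimpleGraph.Walk.isPath_of_length_eq_dist _ ?_
      have := hG.dist_eq_dist_add_one_of_adj k hij
      rw [SimpleGraph.Walk.length_concat]
      omega
    have hpath_eq := (hG.existsUnique_path k i).unique hp hpath
    rw [hpath_eq, SimpleGraph.Walk.penultimate_concat]

variable [Fintype V]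

/-- The sum of `c` over the vertices that lie beyond the edge from `i` to `j`. -/
noncomputable def branchSum (G : SimpleGraph V) (c : V → ℝ) (i j : V) : ℝ :=
  ∑ k with G.dist k j < G.dist k i, c k

theorem branchSum_add_branchSum (hG : G.IsTree) (c : V → ℝ) {i j : V} (hij : G.Adj i j) :
    branchSum G c i j + branchSum G c j i = ∑ k, c k := by
  have hside : ∀ k, G.dist k i < G.dist k j ↔ ¬G.dist k j < G.dist k i := fun k =>
    ⟨fun h => h.not_gt, fun h => lt_of_le_of_ne (not_lt.1 h) (hG.dist_ne_of_adj k hij)⟩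
  simp only [branchSum, hside]
  exact Finset.sum_filter_add_sum_filter_not _ _ _

variable [DecidableRel G.Adj]

theorem add_sum_branchSum (hG : G.IsTree) (c : V → ℝ) (i : V) :
    c i + ∑ j ∈ G.neighborFinset i, branchSum G c i j = ∑ k, c k := by
  classical
  have hcount : ∀ k ∈ Finset.univ.erase i,
      ∑ j ∈ G.neighborFinset i, (if G.dist k j < G.dist k i then c k else 0) = c k := by
    intro k hk
    obtain ⟨j, ⟨hij, hj⟩, hunique⟩ := existsUnique_adj_dist_lt hG (Finset.ne_of_mem_erase hk)
    rw [Finset.sum_eq_single_of_mem j ((G.mem_neighborFinset i j).2 hij), if_pos hj]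
    exact fun h hh hne =>
      if_neg fun hlt => hne (hunique h ⟨(G.mem_neighborFinset i h).1 hh, hlt⟩)
  simp only [branchSum, Finset.sum_filter]
  rw [Finset.sum_comm, ← Finset.add_sum_erase _ _ (Finset.mem_univ i),
    ← Finset.add_sum_erase _ c (Finset.mem_univ i), Finset.sum_congr rfl hcount]
  simp

theorem sum_add_swap_neighborFinset (n : V → V → ℝ) :
    ∑ i, ∑ j ∈ G.neighborFinset i, (n i j + n j i)
      = 2 * ∑ i, ∑ j ∈ G.neighborFinset i, n i j := by
  have hswap : ∑ i, ∑ j ∈ G.neighborFinset i, n j i = ∑ i, ∑ j ∈ G.neighborFinset i, n i j :=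
    Finset.sum_comm' fun i j => by simp [G.adj_comm]
  simp only [Finset.sum_add_distrib]
  rw [hswap, two_mul]

variable [DecidableEq V]

theorem add_sum_erase_branchSum (hG : G.IsTree) (c : V → ℝ) {i j : V} (hij : G.Adj i j) :
    c j + ∑ h ∈ (G.neighborFinset j).erase i, branchSum G c j h = branchSum G c i j := by
  have hj := add_sum_branchSum hG c j
  rw [← Finset.add_sum_erase _ _ ((G.mem_neighborFinset j i).2 hij.symm)] at hj
  linarith [branchSum_add_branchSum hG c hij]

-- The left-hand side `T i` equals `n i j + n j i` for every edge `ij`, so it is a constant `T`.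
-- Adding it up over all vertices uses every edge twice: `#V * T = ∑ k, c k + #E * T`.
theorem add_sum_eq_sum_of_isTree (hG : G.IsTree) {c : V → ℝ} {n : V → V → ℝ}
    (hn : ∀ i j, G.Adj i j → n i j = c j + ∑ h ∈ (G.neighborFinset j).erase i, n j h) (i : V) :
    c i + ∑ j ∈ G.neighborFinset i, n i j = ∑ k, c k := by
  set T : V → ℝ := fun i => c i + ∑ j ∈ G.neighborFinset i, n i j
  have hedge : ∀ i j, G.Adj i j → n i j + n j i = T j := fun i j hij => by
    rw [hn i j hij, add_assoc, Finset.sum_erase_add _ _ ((G.mem_neighborFinset j i).2 hij.symm)]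
  have hconst : ∀ j, T j = T i := forall_of_connected_of_adj hG.connected
    (fun j k hjk hj => by rw [← hedge j k hjk, add_comm, hedge k j hjk.symm, hj]) rfl
  have hvertices : Fintype.card V * T i = ∑ k, c k + ∑ k, ∑ j ∈ G.neighborFinset k, n k j := by
    rw [← Finset.sum_add_distrib, ← nsmul_eq_mul, ← Finset.card_univ, ← Finset.sum_const]
    exact Finset.sum_congr rfl fun k _ => (hconst k).symm
  have hedges : (∑ k, (G.degree k : ℝ)) * T i = 2 * ∑ k, ∑ j ∈ G.neighborFinset k, n k j := by
    rw [← sum_add_swap_neighborFinset, Finset.sum_mul]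
    refine Finset.sum_congr rfl fun k _ => ?_
    rw [← G.card_neighborFinset_eq_degree, ← nsmul_eq_mul, ← Finset.sum_const]
    exact Finset.sum_congr rfl fun j hj =>
      ((hedge k j ((G.mem_neighborFinset k j).1 hj)).trans (hconst j)).symm
  have hdegree : ∑ k, (G.degree k : ℝ) = 2 * G.edgeFinset.card :=
    mod_cast G.sum_degrees_eq_twice_card_edges
  have hcard : (G.edgeFinset.card : ℝ) + 1 = Fintype.card V := mod_cast hG.card_edgeFinset
  rw [hdegree] at hedges
  rw [← hcard] at hvertices
  linarith

theorem sum_neighborSet_ne (i j : V) (f : V → ℝ) :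
    ∑ h : G.neighborSet j with h.val ≠ i, f h = ∑ h ∈ (G.neighborFinset j).erase i, f h := by
  rw [← Finset.filter_ne', Finset.sum_filter, Finset.sum_filter]
  exact (Finset.sum_subtype _ (G.mem_neighborFinset j) fun h => if h ≠ i then f h else 0).symm

end TreeSummaries

theorem add_sq_le_sq_add_mul {a w x : ℝ} (hx : 0 ≤ x) :
    (max (a - w / 2) 0 - a) ^ 2 + max (a - w / 2) 0 * w + (x - max (a - w / 2) 0) ^ 2
      ≤ (x - a) ^ 2 + x * w := by
  rcases max_cases (a - w / 2) 0 with ⟨hmax, _⟩ | ⟨hmax, hneg⟩ <;> rw [hmax]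
  · nlinarith
  · nlinarith [mul_nonneg hx (sub_nonneg.2 hneg.le)]

attribute [ext] Message

namespace Message

variable {ι τ κ : Type*} [Fintype ι] [DecidableEq ι] [Fintype τ] [Fintype κ]
variable {G : SimpleGraph ι} [DecidableRel G.Adj] {φ : ι → ι} {i : ι}

/-- The squared Euclidean distance of two messages, disregarding the demands. -/
noncomputable def distSq (mi mi' : Message G φ τ κ i) : ℝ :=
  ∑ l, (∑ j, (mi.n j l - mi'.n j l) ^ 2 + ((mi.q l : ℝ) - mi'.q l) ^ 2)
    + ∑ t, (∑ j, (mi.β j t - mi'.β j t) ^ 2 + ∑ j, (mi.ν j t - mi'.ν j t) ^ 2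
      + ((mi.s t : ℝ) - mi'.s t) ^ 2)

theorem distSq_nonneg (mi mi' : Message G φ τ κ i) : 0 ≤ mi.distSq mi' := by
  unfold distSq
  positivity

theorem eq_of_distSq_nonpos {mi mi' : Message G φ τ κ i} (hy : mi.y = mi'.y)
    (h : mi.distSq mi' ≤ 0) : mi = mi' := by
  have hzero := h.antisymm (distSq_nonneg mi mi')
  simp (disch := intros; positivity) only [distSq, add_eq_zero_iff_of_nonneg,
    Finset.sum_eq_zero_iff_of_nonneg, Finset.mem_univ, forall_const, sq_eq_zero_iff, sub_eq_zero,
    NNReal.coe_inj] at hzero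
  obtain ⟨hκ, hτ⟩ := hzero
  ext1
  · exact hy
  · exact funext fun l => (hκ l).2
  · exact funext fun t => (hτ t).2
  · exact funext₂ fun j t => (hτ t).1.1 j
  · exact funext₂ fun j l => (hκ l).1 j
  · exact funext₂ fun j t => (hτ t).1.2 j

end Message

namespace Profile

open EnergyCommunity

variable {ι τ κ : Type*} [Fintype ι]
variable {G : SimpleGraph ι} [DecidableRel G.Adj] {φ : ι → ι}

section Payoff

variable {E : EnergyCommunity ι τ κ} {m : Profile G φ τ κ} {i : ι}

theorem qAvg_eq_of_forall_eq {l : κ} {c : ℝ≥0} (h : ∀ j, (m j).q l = c) {j : ι}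
    (hij : G.Adj i j) : m.qAvg i l = c :=
  neighborAvg_eq_of_forall_eq (q := fun j => ((m j).q l : ℝ))
    (fun j => congrArg NNReal.toReal (h j)) hij

theorem sAvg_eq_of_forall_eq {t : τ} {c : ℝ≥0} (h : ∀ j, (m j).s t = c) {j : ι}
    (hij : G.Adj i j) : m.sAvg i t = c :=
  neighborAvg_eq_of_forall_eq (q := fun j => ((m j).s t : ℝ))
    (fun j => congrArg NNReal.toReal (h j)) hij

theorem qAvg_congr {m' : Profile G φ τ κ} (h : ∀ j, G.Adj i j → m' j = m j) :
    m'.qAvg i = m.qAvg i :=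
  funext fun l => congrArg (· / _) <| Finset.sum_congr rfl fun j hj => by
    rw [h j ((G.mem_neighborFinset i j).1 hj)]

theorem sAvg_congr {m' : Profile G φ τ κ} (h : ∀ j, G.Adj i j → m' j = m j) :
    m'.sAvg i = m.sAvg i :=
  funext fun t => congrArg (· / _) <| Finset.sum_congr rfl fun j hj => by
    rw [h j ((G.mem_neighborFinset i j).1 hj)]

variable [DecidableEq ι]

theorem fCon_congr [Fintype τ] {m' : Profile G φ τ κ} {j : ι} (h : m' j = m j) :
    m'.fCon E i j = m.fCon E i j := by
  unfold fCon
  rw [h]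

theorem fPeak_congr {m' : Profile G φ τ κ} {j : ι} (h : m' j = m j) :
    m'.fPeak i j = m.fPeak i j := by
  unfold fPeak
  rw [h]

theorem zeta_congr (hφ : G.Adj i (φ i)) {m' : Profile G φ τ κ}
    (h : ∀ j, G.Adj i j → m' j = m j) : m'.zeta i = m.zeta i := by
  funext t
  rw [zeta, zeta, helperProxy, helperProxy, h _ hφ]
  congr 1
  exact Finset.sum_congr rfl fun j hj =>
    congrFun (fPeak_congr (h j ((G.mem_neighborFinset i j).1 hj))) t

variable [Fintype τ]

/-- The amount by which user `i` is told that constraint `l` is slack. -/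
noncomputable def slack (E : EnergyCommunity ι τ κ) (m : Profile G φ τ κ) (i : ι) (l : κ) : ℝ :=
  E.b l - ∑ j ∈ G.neighborFinset i, m.fCon E i j l - ∑ t, E.a i l t * m.helperProxy i t

theorem slack_congr (hφ : G.Adj i (φ i)) {m' : Profile G φ τ κ}
    (h : ∀ j, G.Adj i j → m' j = m j) : m'.slack E i = m.slack E i := by
  funext l
  simp only [slack, helperProxy, h _ hφ]
  congr 2
  exact Finset.sum_congr rfl fun j hj =>
    congrFun (fCon_congr (h j ((G.mem_neighborFinset i j).1 hj))) l

variable [Nonempty τ] [Fintype κ]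

/-- The surcharges on the unit prices that user `i` has to pay. -/
noncomputable def quotedPrice (E : EnergyCommunity ι τ κ) (m : Profile G φ τ κ) (i : ι) :
    τ → ℝ :=
  radialPrice E.peakPrice (m.sAvg i) (m.zeta i)

/-- The part of the tax of user `i` that does not depend on her demand, if she sends `mi` and the
others send `m`. -/
noncomputable def penalty (E : EnergyCommunity ι τ κ) (m : Profile G φ τ κ) {i : ι}
    (mi : Message G φ τ κ i) : ℝ :=
  ∑ l, (∑ j, (mi.n j l - m.fCon E i j l) ^ 2
      + ((mi.q l - m.qAvg i l) ^ 2 + mi.q l * m.slack E i l))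
    + ∑ t, (∑ j, (mi.β j t - (m j).y t) ^ 2 + ∑ j, (mi.ν j t - m.fPeak i j t) ^ 2
      + ((mi.s t - m.sAvg i t) ^ 2 + mi.s t * (m.zPeak i - m.zeta i t)))

theorem payoff_eq : m.payoff E i
    = E.netUtility i (m.qAvg i) (m.quotedPrice E i) (m i).y - m.penalty E (m i) := by
  have halloc : m.alloc i = (m i).y := rfl
  simp only [payoff, tax, cost, halloc, netUtility, sum_constraintsOf, quotedPrice, penalty, prN,
    conCon, prBeta, prNu, conPeak, slack]
  ring

theorem payoff_update (hφ : ∀ i, G.Adj i (φ i)) (mi : Message G φ τ κ i) :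
    payoff E (Function.update m i mi : Profile G φ τ κ) i
      = E.netUtility i (m.qAvg i) (m.quotedPrice E i) mi.y - m.penalty E mi := by
  set m' : Profile G φ τ κ := Function.update m i mi
  have hi : m' i = mi := Function.update_self i mi m
  have hadj : ∀ j, G.Adj i j → m' j = m j := fun j hij =>
    Function.update_of_ne hij.ne' mi m
  have hhelped : ∀ j : {j // φ j = i}, m' j = m j := fun j =>
    hadj j (by simpa [j.2] using (hφ j).symm)
  have hfCon : ∀ j : G.neighborSet i, m'.fCon E i j = m.fCon E i j := fun j =>
    fCon_congr (hadj j j.2)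
  have hfPeak : ∀ j : G.neighborSet i, m'.fPeak i j = m.fPeak i j := fun j =>
    fPeak_congr (hadj j j.2)
  rw [payoff_eq]
  simp only [penalty, quotedPrice, zPeak, hi, hhelped, hfCon, hfPeak, qAvg_congr hadj,
    sAvg_congr hadj, zeta_congr (hφ i) hadj, slack_congr (hφ i) hadj]

/-- The message of user `i` that minimizes her penalty, given her demand and the messages of the
others. -/
noncomputable def reply (E : EnergyCommunity ι τ κ) (m : Profile G φ τ κ) (i : ι) :
    Message G φ τ κ i where
  y := (m i).y
  q l := (m.qAvg i l - m.slack E i l / 2).toNNReal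
  s t := (m.sAvg i t - (m.zPeak i - m.zeta i t) / 2).toNNReal
  β j := (m j).y
  n j := m.fCon E i j
  ν j := m.fPeak i j

theorem penalty_reply_add_distSq_le (mi : Message G φ τ κ i) :
    m.penalty E (m.reply E i) + mi.distSq (m.reply E i) ≤ m.penalty E mi := by
  have hq := Finset.sum_le_sum fun l (_ : l ∈ Finset.univ) =>
    add_sq_le_sq_add_mul (a := m.qAvg i l) (w := m.slack E i l) (mi.q l).coe_nonneg
  have hs := Finset.sum_le_sum fun t (_ : t ∈ Finset.univ) =>
    add_sq_le_sq_add_mul (a := m.sAvg i t) (w := m.zPeak i - m.zeta i t) (mi.s t).coe_nonneg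
  simp only [penalty, reply, Message.distSq, Real.coe_toNNReal', sub_self, ne_eq,
    OfNat.ofNat_ne_zero, not_false_eq_true, zero_pow, Finset.sum_const_zero, zero_add]
  simp only [Finset.sum_add_distrib] at hq hs ⊢
  linarith

-- Demand and the other reports enter the payoff additively, and `reply` is the unique minimizer of
-- the penalty for a given demand.
theorem isNash_iff (hφ : ∀ i, G.Adj i (φ i)) : m.IsNash E ↔ ∀ i, m i = m.reply E i ∧
    ∀ y, E.netUtility i (m.qAvg i) (m.quotedPrice E i) y
      ≤ E.netUtility i (m.qAvg i) (m.quotedPrice E i) (m i).y := by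
  simp only [IsNash, payoff_update hφ, payoff_eq]
  refine forall_congr' fun i => ⟨fun h => ⟨?_, fun y => ?_⟩, fun ⟨hreply, hy⟩ mi => ?_⟩
  · have hle := h (m.reply E i)
    have hpenalty := penalty_reply_add_distSq_le (E := E) (m := m) (m i)
    exact Message.eq_of_distSq_nonpos rfl (by simp only [reply] at hle hpenalty ⊢; linarith)
  · have hle := h { m i with y := y }
    exact (sub_le_sub_iff_right _).1 hle
  · have hpenalty := penalty_reply_add_distSq_le (E := E) (m := m) mi
    rw [← hreply] at hpenalty
    linarith [hy mi.y, mi.distSq_nonneg (m i)]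

end Payoff

section ExactReports

variable [DecidableEq ι] [Fintype τ] {E : EnergyCommunity ι τ κ} {m : Profile G φ τ κ}

/-- The proxies and summaries in `m` are those that incur no penalty. -/
structure HasExactReports (E : EnergyCommunity ι τ κ) (m : Profile G φ τ κ) : Prop where
  β_eq : ∀ i (j : {j // φ j = i}), (m i).β j = (m j).y
  n_eq : ∀ i (j : G.neighborSet i), (m i).n j = m.fCon E i j
  ν_eq : ∀ i (j : G.neighborSet i), (m i).ν j = m.fPeak i j

theorem HasExactReports.helperProxy_eq (h : m.HasExactReports E) (i : ι) :
    m.helperProxy i = m.alloc i :=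
  h.β_eq (φ i) ⟨i, rfl⟩

theorem HasExactReports.zeta_eq (htree : G.IsTree) (h : m.HasExactReports E) (i : ι) :
    m.zeta i = fun t => ∑ k, m.alloc k t := by
  funext t
  rw [zeta, h.helperProxy_eq, add_comm]
  refine add_sum_eq_sum_of_isTree htree (c := fun k => m.alloc k t)
    (n := fun i j => m.fPeak i j t) (fun i j _ => ?_) i
  rw [fPeak]
  simp only [h.ν_eq]
  rw [sum_neighborSet_ne i j fun h => m.fPeak j h t]
  rfl

theorem HasExactReports.slack_eq (htree : G.IsTree) (h : m.HasExactReports E) (i : ι) (l : κ) :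
    m.slack E i l = E.b l - ∑ k, ∑ t, E.a k l t * m.alloc k t := by
  rw [slack, h.helperProxy_eq, sub_sub, add_comm]
  congr 1
  refine add_sum_eq_sum_of_isTree htree (c := fun k => ∑ t, E.a k l t * m.alloc k t)
    (n := fun i j => m.fCon E i j l) (fun i j _ => ?_) i
  rw [fCon]
  simp only [h.n_eq]
  rw [sum_neighborSet_ne i j fun h => m.fCon E j h l]
  rfl

/-- The profile in which everyone demands her part of `x`, reports exactly and quotes the constraint
prices `q` and the peak surcharges `s`. -/
noncomputable def truthful (E : EnergyCommunity ι τ κ) (x : ι → τ → ℝ) (q : κ → ℝ≥0) (s : τ → ℝ≥0) :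
    Profile G φ τ κ := fun i =>
  { y := x i
    q := q
    s := s
    β := fun j => x j
    n := fun j l => branchSum G (fun k => ∑ t, E.a k l t * x k t) i j
    ν := fun j t => branchSum G (fun k => x k t) i j }

theorem hasExactReports_truthful (htree : G.IsTree) (x : ι → τ → ℝ) (q : κ → ℝ≥0) (s : τ → ℝ≥0) :
    (truthful E x q s : Profile G φ τ κ).HasExactReports E where
  β_eq _ _ := rfl
  n_eq i j := funext fun l => by
    have := add_sum_erase_branchSum htree (fun k => ∑ t, E.a k l t * x k t) j.2
    rw [← sum_neighborSet_ne] at this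
    exact this.symm
  ν_eq i j := funext fun t => by
    have := add_sum_erase_branchSum htree (fun k => x k t) j.2
    rw [← sum_neighborSet_ne] at this
    exact this.symm

end ExactReports

section Equilibrium

variable [DecidableEq ι] [Fintype τ] [Nonempty τ] [Fintype κ]
variable {E : EnergyCommunity ι τ κ} {m : Profile G φ τ κ}

theorem IsNash.hasExactReports (hφ : ∀ i, G.Adj i (φ i)) (h : m.IsNash E) :
    m.HasExactReports E := by
  have hreply := fun i => ((isNash_iff hφ).1 h i).1
  exact ⟨fun i => congrFun (congrArg Message.β (hreply i)),
    fun i => congrFun (congrArg Message.n (hreply i)),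
    fun i => congrFun (congrArg Message.ν (hreply i))⟩

theorem IsNash.exists_qAvg_eq (htree : G.IsTree) (hφ : ∀ i, G.Adj i (φ i)) (h : m.IsNash E)
    (l : κ) : ∃ c : ℝ≥0, (∀ i, m.qAvg i l = c) ∧
      ∑ k, ∑ t, E.a k l t * m.alloc k t ≤ E.b l ∧
      c * (E.b l - ∑ k, ∑ t, E.a k l t * m.alloc k t) = 0 := by
  have hq : ∀ i, (m i).q l = (neighborAvg G (fun j => (m j).q l) i
      - (E.b l - ∑ k, ∑ t, E.a k l t * m.alloc k t) / 2).toNNReal := fun i => by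
    rw [← (h.hasExactReports hφ).slack_eq htree i l]
    exact congrFun (congrArg Message.q ((isNash_iff hφ).1 h i).1) l
  obtain ⟨c, hc, hslack, hmul⟩ :=
    (forall_eq_toNNReal_neighborAvg_sub_iff htree.connected fun i => ⟨φ i, hφ i⟩).1 hq
  exact ⟨c, fun i => qAvg_eq_of_forall_eq hc (hφ i), by linarith, by linarith⟩

theorem IsNash.exists_sAvg_eq (htree : G.IsTree) (hφ : ∀ i, G.Adj i (φ i)) (h : m.IsNash E)
    (t : τ) : ∃ c : ℝ≥0, (∀ i, m.sAvg i t = c) ∧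
      c * (peak (fun t => ∑ k, m.alloc k t) - ∑ k, m.alloc k t) = 0 := by
  have hs : ∀ i, (m i).s t = (neighborAvg G (fun j => (m j).s t) i
      - (peak (fun t => ∑ k, m.alloc k t) - ∑ k, m.alloc k t) / 2).toNNReal := fun i => by
    have hreply := congrFun (congrArg Message.s ((isNash_iff hφ).1 h i).1) t
    simp only [reply, zPeak, (h.hasExactReports hφ).zeta_eq htree] at hreply
    exact hreply
  obtain ⟨c, hc, -, hmul⟩ :=
    (forall_eq_toNNReal_neighborAvg_sub_iff htree.connected fun i => ⟨φ i, hφ i⟩).1 hs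
  exact ⟨c, fun i => sAvg_eq_of_forall_eq hc (hφ i), by linarith⟩

theorem IsNash.exists_isSupportedBy (htree : G.IsTree) (hφ : ∀ i, G.Adj i (φ i))
    (hp : 0 ≤ E.peakPrice) (h : m.IsNash E) : ∃ q r, E.IsSupportedBy m.alloc q r := by
  choose q hq hfeasible hq_slack using h.exists_qAvg_eq htree hφ
  choose s hs hs_slack using h.exists_sAvg_eq htree hφ
  have hqAvg : ∀ i, m.qAvg i = fun l => (q l : ℝ) := fun i => funext fun l => hq l i
  have hsAvg : ∀ i, m.sAvg i = fun t => (s t : ℝ) := fun i => funext fun t => hs t i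
  have hs_nonneg : 0 ≤ fun t => (s t : ℝ) := fun t => (s t).coe_nonneg
  have hquoted : ∀ i, m.quotedPrice E i
      = radialPrice E.peakPrice (fun t => s t) fun t => ∑ k, m.alloc k t := fun i => by
    rw [quotedPrice, hsAvg, (h.hasExactReports hφ).zeta_eq htree]
  refine ⟨fun l => q l, radialPrice E.peakPrice (fun t => s t) fun t => ∑ k, m.alloc k t,
    hfeasible, fun l => (q l).coe_nonneg, radialPrice_nonneg hp hs_nonneg _, hq_slack,
    radialPrice_mul_peak_sub _ hs_slack, sum_radialPrice _ hs_nonneg _, fun i y => ?_⟩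
  have hbest := ((isNash_iff hφ).1 h i).2 y
  rwa [hqAvg, hquoted] at hbest

theorem isNash_truthful (htree : G.IsTree) (hφ : ∀ i, G.Adj i (φ i)) {x : ι → τ → ℝ}
    {q : κ → ℝ≥0} {r : τ → ℝ≥0} (h : E.IsSupportedBy x (fun l => q l) fun t => r t) :
    (truthful E x q r : Profile G φ τ κ).IsNash E := by
  set m : Profile G φ τ κ := truthful E x q r
  have hexact : m.HasExactReports E := hasExactReports_truthful htree x q r
  have hqAvg : ∀ i, m.qAvg i = fun l => (q l : ℝ) := fun i => funext fun l =>
    qAvg_eq_of_forall_eq (fun _ => rfl) (hφ i)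
  have hsAvg : ∀ i, m.sAvg i = fun t => (r t : ℝ) := fun i => funext fun t =>
    sAvg_eq_of_forall_eq (fun _ => rfl) (hφ i)
  have hquoted : ∀ i, m.quotedPrice E i = fun t => (r t : ℝ) := fun i => by
    rw [quotedPrice, hsAvg, ← h.sum_r, radialPrice_sum_self h.r_nonneg]
  refine (isNash_iff hφ).2 fun i => ⟨?_, fun y => ?_⟩
  · ext1
    · rfl
    · funext l
      have hslack : m.slack E i l = E.b l - ∑ k, ∑ t, E.a k l t * x k t :=
        hexact.slack_eq htree i l
      simp only [reply, hqAvg, hslack]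
      exact (eq_toNNReal_coe_sub_iff (c := q l)).2
        ⟨by linarith [h.feasible l], by linarith [h.q_mul_slack l]⟩
    · funext t
      have hzeta : m.zeta i = fun t => ∑ k, x k t := hexact.zeta_eq htree i
      simp only [reply, hsAvg, zPeak, hzeta]
      exact (eq_toNNReal_coe_sub_iff (c := r t)).2
        ⟨by linarith [le_peak (fun t => ∑ k, x k t) t], by linarith [h.r_mul_slack t]⟩
    · exact funext (hexact.β_eq i)
    · exact funext (hexact.n_eq i)
    · exact funext (hexact.ν_eq i)
  · rw [hqAvg, hquoted]
    exact h.netUtility_le i y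

end Equilibrium

end Profile

theorem theorem5_general {ι τ κ : Type*} [Fintype ι] [DecidableEq ι] [Fintype τ] [Nonempty τ]
    [Fintype κ] {E : EnergyCommunity ι τ κ}
    (hconc : ∀ i t, StrictConcaveOn ℝ Set.univ (E.v i t)) (hp : 0 ≤ E.peakPrice)
    (hne : E.feasible.Nonempty) (hbdd : Bornology.IsBounded E.feasible)
    {G : SimpleGraph ι} [DecidableRel G.Adj] (htree : G.IsTree)
    {φ : ι → ι} (hφ : ∀ i, G.Adj i (φ i)) :
    (∃! x, E.IsOptimalAllocation x) ∧
      (∃ m : Profile G φ τ κ, m.IsNash E) ∧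
      ∀ m : Profile G φ τ κ, m.IsNash E → E.IsOptimalAllocation m.alloc := by
  have hunique := EnergyCommunity.existsUnique_isOptimalAllocation hconc hp hne hbdd
  refine ⟨hunique, ?_, fun m hm => ?_⟩
  · obtain ⟨x, hx⟩ := hunique.exists
    obtain ⟨q, r, h⟩ := hx.exists_isSupportedBy (fun i t => (hconc i t).concaveOn) hp
    lift q to κ → ℝ≥0 using h.q_nonneg
    lift r to τ → ℝ≥0 using h.r_nonneg
    exact ⟨Profile.truthful E x q r, Profile.isNash_truthful htree hφ h⟩
  · obtain ⟨q, r, h⟩ := hm.exists_isSupportedBy htree hφ hp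
    exact h.isOptimalAllocation

theorem theorem5 {ι τ κ : Type*} [Fintype ι] [DecidableEq ι] [Fintype τ] [Nonempty τ] [Fintype κ]
    (E : EnergyCommunity ι τ κ)
    (hv : ∀ i t, Differentiable ℝ (E.v i t) ∧ Differentiable ℝ (deriv (E.v i t)))
    (hconc : ∀ i t, StrictConcaveOn ℝ Set.univ (E.v i t))
    (hp : 0 ≤ E.peakPrice)
    (hne : E.feasible.Nonempty) (hbdd : Bornology.IsBounded E.feasible)
    -- the message exchange network, a spanning tree of it, and the helpers
    (GR : SimpleGraph ι) (hGR : GR.Connected)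
    (G : SimpleGraph ι) [DecidableRel G.Adj] (hG : G ≤ GR) (htree : G.IsTree)
    (φ : ι → ι) (hφ : ∀ i, φ i ∈ G.neighborSet i) :
    (∃! x, E.IsOptimalAllocation x) ∧
      (∃ m : Profile G φ τ κ, m.IsNash E) ∧
      ∀ m : Profile G φ τ κ, m.IsNash E → E.IsOptimalAllocation m.alloc :=
  theorem5_general hconc hp hne hbdd htree hφ
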